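/- Let $f\in\mathbb C[z]$ be a nonconstant polynomial of degree $d$, and let $\Sigma$ be the finite set of its critical values. For $t\in\mathbb C\setminus\Sigma$ the fibre $f^{-1}(t)$ consists of $d$ distinct points; they define multivalued analytic functions $z_1(t),\dots,z_d(t)$ on $\mathbb C\setminus\Sigma$. A cycle of $f$ is a formal sum $C(t)=\sum_{j=1}^d n_jz_j(t)$ with $n_j\in\mathbb Z$ and $\sum_j n_j=0$; it is simple if $C(t)=z_k(t)-z_i(t)$ with $i\neq k$. For $g\in\mathbb C[z]$ the abelian integral of $g$ along $C$ is the multivalued function $\int_{C(t)}g=\sum_j n_j\,g(z_j(t))$ on $\mathbb C\setminus\Sigma$. Let $Z_1(f,g,C)$ be the number of isolated points of the set of all $t\in\mathbb C\setminus\Sigma$ at which at least one branch of $\int_{C(t)}g$ vanishes, and let $\dim(f,n,C)$ be the complex dimension of the space of the multivalued functions $t\mapsto\int_{C(t)}g$ with $\deg g\le n$. Put $$Z_1(m,n)=\max_{\deg f\le m,\ \deg g\le n,\ C}Z_1(f,g,C),\qquad \dim\mathcal P(m,n)=\max_{\deg f\le m,\ C}\dim(f,n,C),$$ where $f$ is nonconstant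 and $C$ runs over all cycles of $f$, and $$Z_1^S(m,n)=\max_{\deg f=m,\ \deg g=n,\ C\text{ simple}}Z_1(f,g,C),\qquad \dim\mathcal P^S(m,n)=\max_{\deg f=m,\ C\text{ simple}}\dim(f,n,C).$$ Theorem D. For every $m\ge 2$ the four numbers $Z_1(m,m-1)$, $\dim\mathcal P(m,m-1)$, $Z_1^S(m,m-1)$, $\dim\mathcal P^S(m,m-1)$ are finite and the two dimensions are positive, and (i) $\displaystyle\lim_{m\to\infty}\frac{Z_1(m,m-1)}{\dim\mathcal P(m,m-1)}=\infty$; (ii) $\displaystyle\lim_{m\to\infty}\frac{Z_1^S(m,m-1)}{\dim\mathcal P^S(m,m-1)}=\infty$. In particular, for all sufficiently large $m$ the Chebyshev property (number of zeros strictly less than the dimension) fails, that is, $Z_1(m,m-1)\ge\dim\mathcal P(m,m-1)$ and $Z_1^S(m,m-1)\ge\dim\mathcal P^S(m,m-1)$; and the asymptotic Chebyshev property fails, that is, neither of the two ratios tends to $1$. -/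

import Mathlib

open Polynomial Filter Topology

noncomputable section

/-- The set of critical values of a complex polynomial. -/
def criticalValues (f : ℂ[X]) : Set ℂ :=
  {t | ∃ z : ℂ, f.derivative.eval z = 0 ∧ f.eval z = t}

/-- Pairs `(t, z)` where `t` is a regular value of `f` and `z` enumerates the `deg f` distinct
points of the fibre `f⁻¹(t)`. It is a covering of the set of regular values, so continuing
an enumeration of a fibre analytically along a path of regular values is the same as lifting
the path to this set. -/
def labelledFibres (f : ℂ[X]) : Set (ℂ × (Fin f.natDegree → ℂ)) :=
  {p | p.1 ∉ criticalValues f ∧ Function.Injective p.2 ∧ ∀ j, f.eval (p.2 j) = p.1}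

/-- A zero-dimensional cycle `C(t) = ∑ n_j z_j(t)` of `f`, with `∑ n_j = 0`. The multivalued
functions `z_j` are given by their values `root j` at a regular value `base`. -/
structure ZeroCycle (f : ℂ[X]) where
  base : ℂ
  root : Fin f.natDegree → ℂ
  mem_fibres : (base, root) ∈ labelledFibres f
  weight : Fin f.natDegree → ℤ
  sum_weight : ∑ j, weight j = 0

namespace ZeroCycle

/-- A simple cycle is a difference of two distinct preimages `z_k(t) - z_i(t)`. -/
def IsSimple {f : ℂ[X]} (C : ZeroCycle f) : Prop :=
  ∃ i k, i ≠ k ∧ C.weight = Pi.single k 1 - Pi.single i 1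

/-- All branches of the tuple `(z_j)`: the pairs `(t, z)` such that `z = (z_j(t))_j` for the
continuation of `(z_j)` along some path of regular values from the base point to `t`. The
multivalued functions attached to `C` are single-valued functions on this set. -/
def branches {f : ℂ[X]} (C : ZeroCycle f) : Set (ℂ × (Fin f.natDegree → ℂ)) :=
  {p | JoinedIn (labelledFibres f) (C.base, C.root) p}

/-- The abelian integral of `g` along `C`, a multivalued function of `t`, linear in `g`; its
value on the branch `(t, z)` is `∑ n_j g(z_j)`. -/
def abelianIntegral {f : ℂ[X]} (C : ZeroCycle f) : ℂ[X] →ₗ[ℂ] (C.branches → ℂ) where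
  toFun g p := ∑ j, (C.weight j : ℂ) * g.eval (p.1.2 j)
  map_add' g h := by
    funext p
    simp [mul_add, Finset.sum_add_distrib]
  map_smul' a g := by
    funext p
    simp [Finset.mul_sum, mul_left_comm]

/-- The first Melnikov function `M₁ = -∫_C g`. -/
def melnikov {f : ℂ[X]} (C : ZeroCycle f) (g : ℂ[X]) : C.branches → ℂ :=
  -C.abelianIntegral g

/-- The regular values `t` at which at least one branch of `M₁` vanishes. -/
def zeroSet {f : ℂ[X]} (C : ZeroCycle f) (g : ℂ[X]) : Set ℂ :=
  {t | ∃ p : C.branches, p.1.1 = t ∧ C.melnikov g p = 0}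

/-- The number of isolated solutions `t` of `M₁(t) = 0`. -/
def numZeros {f : ℂ[X]} (C : ZeroCycle f) (g : ℂ[X]) : ℕ∞ :=
  {t | t ∈ C.zeroSet g ∧ ∀ᶠ s in 𝓝[≠] t, s ∉ C.zeroSet g}.encard

/-- The space of abelian integrals along `C` of polynomials of degree at most `n`. -/
def integralSpace {f : ℂ[X]} (C : ZeroCycle f) (n : ℕ) : Submodule ℂ (C.branches → ℂ) :=
  (degreeLE ℂ n).map C.abelianIntegral

/-- The complex dimension of the space of abelian integrals along `C` of polynomials of degree
at most `n`. -/
def dimIntegrals {f : ℂ[X]} (C : ZeroCycle f) (n : ℕ) : ℕ :=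
  Module.finrank ℂ (C.integralSpace n)

end ZeroCycle

/-- `Z₁(m, n)`: the maximal number of isolated zeros of abelian integrals, for `f` nonconstant of
degree at most `m`, `g` of degree at most `n` and any cycle of `f`. -/
def maxZeros (m n : ℕ) : ℕ∞ :=
  sSup {k | ∃ (f g : ℂ[X]) (C : ZeroCycle f),
    0 < f.natDegree ∧ f.natDegree ≤ m ∧ g.natDegree ≤ n ∧ k = C.numZeros g}

/-- `dim P(m, n)`: the maximal dimension of the space of abelian integrals of polynomials of degree
at most `n` along a cycle of a nonconstant polynomial of degree at most `m`. -/
def maxDim (m n : ℕ) : ℕ∞ :=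
  sSup {k | ∃ (f : ℂ[X]) (C : ZeroCycle f),
    0 < f.natDegree ∧ f.natDegree ≤ m ∧ k = (C.dimIntegrals n : ℕ∞)}

/-- `Z₁ˢ(m, n)`: the maximal number of isolated zeros of abelian integrals along simple cycles,
for `f` of degree `m` and `g` of degree `n`. -/
def maxZerosSimple (m n : ℕ) : ℕ∞ :=
  sSup {k | ∃ (f g : ℂ[X]) (C : ZeroCycle f),
    f.natDegree = m ∧ g.natDegree = n ∧ C.IsSimple ∧ k = C.numZeros g}

/-- `dim Pˢ(m, n)`: the maximal dimension of the space of abelian integrals of polynomials of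
degree at most `n` along a simple cycle of a polynomial of degree `m`. -/
def maxDimSimple (m n : ℕ) : ℕ∞ :=
  sSup {k | ∃ (f : ℂ[X]) (C : ZeroCycle f),
    f.natDegree = m ∧ C.IsSimple ∧ k = (C.dimIntegrals n : ℕ∞)}

/-- `Z₁(m, n) / dim P(m, n)` as a real number. -/
def ratio (m n : ℕ) : ℝ :=
  ((maxZeros m n).toNat : ℝ) / ((maxDim m n).toNat : ℝ)

/-- `Z₁ˢ(m, n) / dim Pˢ(m, n)` as a real number. -/
def ratioSimple (m n : ℕ) : ℝ :=
  ((maxZerosSimple m n).toNat : ℝ) / ((maxDimSimple m n).toNat : ℝ)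

end

/-! ### Labelled fibres: factorisation, local sections, monodromy -/

section Fibres

variable {f : ℂ[X]}

/-! With n = m - 1, the dimensions are at most n + 1, so quadratically many zeros for one simple
cycle suffice. Take f = z^(n+1) - c z^n and g = z^n + z. A zero of a branch is a pair x ≠ y with
f(x) = f(y) and g(x) = g(y), and by `double_point_iff` these pairs are exactly the 2-cycles of z ↦
z^n + c. At c = 0 there are at least n^2 - n periodic points, all roots of unity. Many of their
values p^(n+1) coincide, but the first derivatives in c separate different 2-cycles, so some c ≠ 0
gives at least (n^2 - n)/2 distinct regular values (`exists_many_double_values`). All of them count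
for a single cycle: the ordered pairs in common fibres are parametrised by the connected set of
admissible ratios y/x, so monodromy is transitive on them (`powMulSub_exists_joinedIn`).

Finiteness (`ZeroCycle.numZeros_le`) comes from the elementary symmetric functions of all permuted
branches. They are polynomials in t of bounded degree, and the last one that is not identically zero
vanishes at every isolated zero. -/

theorem finite_criticalValues (hf : 0 < f.natDegree) : (criticalValues f).Finite := by
  have h0 : f.derivative ≠ 0 := fun h => hf.ne' (derivative_eq_zero.1 h)
  refine ((f.derivative.rootSet_finite ℂ).image fun z => f.eval z).subset ?_
  rintro t ⟨z, hz, rfl⟩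
  exact ⟨z, by simp [mem_rootSet, h0, hz], rfl⟩

theorem sub_C_eq_prod_of_labelledFibres (hf : 0 < f.natDegree) {t : ℂ}
    {z : Fin f.natDegree → ℂ} (h : (t, z) ∈ labelledFibres f) :
    f - C t = C f.leadingCoeff * ∏ j, (X - C (z j)) := by
  have hdeg : (f - C t).natDegree = f.natDegree := natDegree_sub_C
  have hf0 : f - C t ≠ 0 := ne_zero_of_natDegree_gt (hdeg ▸ hf)
  have hle : Finset.univ.val.map z ≤ (f - C t).roots := by
    rw [Multiset.le_iff_subset (Finset.univ.nodup.map h.2.1)]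
    intro x hx
    obtain ⟨j, -, rfl⟩ := Multiset.mem_map.1 hx
    have := h.2.2 j
    simp only at this
    simp [mem_roots hf0, this]
  have heq : Finset.univ.val.map z = (f - C t).roots :=
    Multiset.eq_of_le_of_card_le hle ((card_roots' _).trans (by simp [hdeg]))
  have := C_leadingCoeff_mul_prod_multiset_X_sub_C
    (p := f - C t) (by rw [← heq]; simp [hdeg])
  rw [← heq, Multiset.map_map, leadingCoeff, coeff_sub, hdeg, coeff_C_of_ne_zero hf.ne', sub_zero]
    at this
  exact this.symm

theorem exists_eq_of_labelledFibres (hf : 0 < f.natDegree) {t : ℂ}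
    {z : Fin f.natDegree → ℂ} (h : (t, z) ∈ labelledFibres f) {x : ℂ} (hx : f.eval x = t) :
    ∃ j, z j = x := by
  have := congrArg (eval x) (sub_C_eq_prod_of_labelledFibres hf h)
  have hlc : f.leadingCoeff ≠ 0 := leadingCoeff_ne_zero.2 (ne_zero_of_natDegree_gt hf)
  simp only [eval_sub, hx, eval_C, sub_self, eval_mul, eval_prod, eval_X, zero_eq_mul, hlc,
    false_or, Finset.prod_eq_zero_iff, Finset.mem_univ, true_and] at this
  exact this.imp fun j hj => (sub_eq_zero.1 hj).symm

/-- At a regular value f - t has no root in common with f', so its roots are simple and there are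
deg f of them. -/
theorem exists_labelledFibres (hf : 0 < f.natDegree) {t : ℂ} (ht : t ∉ criticalValues f) :
    ∃ z : Fin f.natDegree → ℂ, (t, z) ∈ labelledFibres f := by
  have hdeg : (f - C t).natDegree = f.natDegree := natDegree_sub_C
  have hf0 : f - C t ≠ 0 := ne_zero_of_natDegree_gt (hdeg ▸ hf)
  have hnd : (f - C t).roots.Nodup := by
    refine nodup_roots_iff_of_splits hf0 (IsAlgClosed.splits _) |>.2 ?_
    refine isCoprime_of_irreducible_dvd (by simp [hf0]) fun p hp h1 h2 => ?_
    obtain ⟨z, hz⟩ := IsAlgClosed.exists_root p (degree_pos_of_irreducible hp).ne'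
    have e1 := (hz.dvd h1)
    have e2 := (hz.dvd h2)
    refine ht ⟨z, by simpa using e2, ?_⟩
    simpa [sub_eq_zero] using e1
  have hcard : (f - C t).roots.toFinset.card = f.natDegree := by
    rw [Multiset.toFinset_card_of_nodup hnd, ← hdeg]
    exact splits_iff_card_roots.1 (IsAlgClosed.splits _)
  let e := (f - C t).roots.toFinset.equivFinOfCardEq hcard
  refine ⟨fun j => (e.symm j : ℂ), ht, ?_, fun j => ?_⟩
  · exact Subtype.val_injective.comp e.symm.injective
  · have := Multiset.mem_toFinset.1 (e.symm j).2
    rw [mem_roots hf0, IsRoot, eval_sub, eval_C, sub_eq_zero] at this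
    exact this

theorem labelledFibres_comp_perm {t : ℂ} {z : Fin f.natDegree → ℂ}
    (h : (t, z) ∈ labelledFibres f) (σ : Equiv.Perm (Fin f.natDegree)) :
    (t, z ∘ σ) ∈ labelledFibres f :=
  ⟨h.1, h.2.1.comp σ.injective, fun j => h.2.2 (σ j)⟩

theorem exists_perm_of_labelledFibres (hf : 0 < f.natDegree) {t : ℂ}
    {z w : Fin f.natDegree → ℂ} (hz : (t, z) ∈ labelledFibres f)
    (hw : (t, w) ∈ labelledFibres f) : ∃ σ : Equiv.Perm (Fin f.natDegree), w = z ∘ σ := by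
  choose σ hσ using fun j => exists_eq_of_labelledFibres hf hz (hw.2.2 j)
  have hinj : Function.Injective σ := fun i j hij => hw.2.1 (by rw [← hσ i, ← hσ j, hij])
  exact ⟨Equiv.ofBijective σ (Finite.injective_iff_bijective.1 hinj), funext fun j => (hσ j).symm⟩

/-- The fibres of a polynomial over regular values form a covering: a labelled fibre extends to
a continuous local section. -/
theorem exists_local_section (hf : 0 < f.natDegree) {t₀ : ℂ} {z₀ : Fin f.natDegree → ℂ}
    (h : (t₀, z₀) ∈ labelledFibres f) :
    ∃ Z : ℂ → Fin f.natDegree → ℂ, ∃ ε > 0, Z t₀ = z₀ ∧ ContinuousOn Z (Metric.ball t₀ ε) ∧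
      (∀ t ∈ Metric.ball t₀ ε, (t, Z t) ∈ labelledFibres f) ∧
      ∀ j, ∀ᶠ x in 𝓝 (z₀ j), Z (f.eval x) j = x := by
  have hd : ∀ j, f.derivative.eval (z₀ j) ≠ 0 := fun j hj => h.1 ⟨z₀ j, hj, h.2.2 j⟩
  have hs : ∀ j, HasStrictDerivAt (fun x => f.eval x) (f.derivative.eval (z₀ j)) (z₀ j) :=
    fun j => f.hasStrictDerivAt _
  have hsF := fun j => (hs j).hasStrictFDerivAt_equiv (hd j)
  let e := fun j => (hsF j).toOpenPartialHomeomorph (fun x => f.eval x)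
  have hz : ∀ j, f.eval (z₀ j) = t₀ := h.2.2
  have he : ∀ j x, e j x = f.eval x := fun j x => rfl
  have hsrc : ∀ j, z₀ j ∈ (e j).source := fun j => (hsF j).mem_toOpenPartialHomeomorph_source
  have htgt : ∀ j, t₀ ∈ (e j).target := fun j => by
    have := (hsF j).image_mem_toOpenPartialHomeomorph_target
    rwa [hz j] at this
  let Z : ℂ → Fin f.natDegree → ℂ := fun t j => (e j).symm t
  have hZ0 : Z t₀ = z₀ := by
    funext j
    have := (e j).left_inv (hsrc j)
    rwa [he, hz j] at this
  have hcont : ∀ j, ContinuousAt (fun t => Z t j) t₀ := fun j =>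
    (e j).continuousAt_symm (htgt j)
  -- Regularity of t and distinctness of the local inverses are open conditions, so both persist on
  -- a small ball.
  have hnear : ∀ᶠ t in 𝓝 t₀, t ∉ criticalValues f ∧ (∀ j, t ∈ (e j).target) ∧
      ∀ i j, i ≠ j → Z t i ≠ Z t j := by
    refine ((finite_criticalValues hf).isClosed.isOpen_compl.eventually_mem h.1).and
      ((eventually_all.2 fun j => (e j).open_target.eventually_mem (htgt j)).and ?_)
    refine eventually_all.2 fun i => eventually_all.2 fun j => ?_
    by_cases hij : i = j
    · simp [hij]
    · have : Z t₀ i ≠ Z t₀ j := by rw [hZ0]; exact fun h' => hij (h.2.1 h')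
      exact (((hcont i).ne_iff_eventually_ne (hcont j)).1 this).mono fun _ h _ => h
  obtain ⟨ε, hε, hball⟩ := Metric.eventually_nhds_iff_ball.1 hnear
  refine ⟨Z, ε, hε, hZ0, ?_, fun t ht => ⟨(hball t ht).1, ?_, fun j => ?_⟩, fun j => ?_⟩
  · refine continuousOn_pi.2 fun j => ?_
    exact (e j).continuousOn_symm.mono fun t ht => (hball t ht).2.1 j
  · exact fun i j hij => by_contra fun hne => (hball t ht).2.2 i j hne hij
  · exact (e j).right_inv ((hball t ht).2.1 j)
  · exact ((e j).open_source.eventually_mem (hsrc j)).mono fun x hx => (e j).left_inv hx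

theorem joinedIn_labelledFibres_of_section {t₀ : ℂ} {Z : ℂ → Fin f.natDegree → ℂ} {ε : ℝ}
    (hZ : ContinuousOn Z (Metric.ball t₀ ε))
    (hmem : ∀ t ∈ Metric.ball t₀ ε, (t, Z t) ∈ labelledFibres f)
    (σ : Equiv.Perm (Fin f.natDegree)) {s t : ℂ}
    (hs : s ∈ Metric.ball t₀ ε) (ht : t ∈ Metric.ball t₀ ε) :
    JoinedIn (labelledFibres f) (s, Z s ∘ σ) (t, Z t ∘ σ) := by
  have hj : JoinedIn (Metric.ball t₀ ε) s t :=
    ((convex_ball t₀ ε).isPathConnected ⟨s, hs⟩).joinedIn s hs t ht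
  have hc : ContinuousOn (fun t => (t, Z t ∘ σ)) (Metric.ball t₀ ε) :=
    continuousOn_id.prodMk (continuousOn_pi.2 fun j => (continuousOn_pi.1 hZ) (σ j))
  refine (hj.map_continuousOn hc).mono ?_
  rintro _ ⟨r, hr, rfl⟩
  exact labelledFibres_comp_perm (hmem r hr) σ

/-- A connected family of ordered pairs of distinct points in fibres over regular values lies in
the monodromy orbit of any of its members. -/
theorem exists_joinedIn_of_isPreconnected (hf : 0 < f.natDegree) {S : Type*} [TopologicalSpace S]
    {U : Set S} (hU : IsPreconnected U) {x y : S → ℂ} (hx : ContinuousOn x U)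
    (hy : ContinuousOn y U) (hxy : ∀ s ∈ U, f.eval (x s) = f.eval (y s))
    (hreg : ∀ s ∈ U, f.eval (x s) ∉ criticalValues f) {b : ℂ × (Fin f.natDegree → ℂ)}
    (i k : Fin f.natDegree) (hb : b ∈ labelledFibres f) {s₀ s₁ : S} (hs₀ : s₀ ∈ U) (hs₁ : s₁ ∈ U)
    (hbx : b.2 i = x s₀) (hby : b.2 k = y s₀) :
    ∃ z, JoinedIn (labelledFibres f) b (f.eval (x s₁), z) ∧ z i = x s₁ ∧ z k = y s₁ := by
  let P : S → Prop := fun s =>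
    ∃ z, JoinedIn (labelledFibres f) b (f.eval (x s), z) ∧ z i = x s ∧ z k = y s
  have hP0 : P s₀ := by
    have : f.eval (x s₀) = b.1 := by rw [← hbx]; exact hb.2.2 i
    exact ⟨b.2, by rw [this]; exact JoinedIn.refl hb, hbx, hby⟩
  -- `P` is locally constant on `U`; preconnectedness then carries it from `s₀` to `s₁`.
  have hloc : ∀ s ∈ U, ∀ᶠ r in 𝓝[U] s, (P r ↔ P s) := by
    intro s hs
    obtain ⟨z₀, hz₀⟩ := exists_labelledFibres hf (hreg s hs)
    obtain ⟨Z, ε, hε, hZ0, hZc, hZm, hZu⟩ := exists_local_section hf hz₀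
    obtain ⟨a, ha⟩ := exists_eq_of_labelledFibres hf hz₀ rfl
    obtain ⟨c, hc⟩ := exists_eq_of_labelledFibres hf hz₀ (hxy s hs).symm
    have h1 : ∀ᶠ r in 𝓝[U] s, Z (f.eval (x r)) a = x r :=
      (hx s hs).eventually (ha ▸ hZu a)
    have h2 : ∀ᶠ r in 𝓝[U] s, Z (f.eval (y r)) c = y r :=
      (hy s hs).eventually (hc ▸ hZu c)
    have h3 : ∀ᶠ r in 𝓝[U] s, f.eval (x r) ∈ Metric.ball (f.eval (x s)) ε :=
      ((f.continuous.continuousAt.comp_continuousWithinAt (hx s hs))).eventually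
        (Metric.ball_mem_nhds _ hε)
    have hsb : f.eval (x s) ∈ Metric.ball (f.eval (x s)) ε := Metric.mem_ball_self hε
    -- Any labelling over `p` is the local section up to a permutation, so following that section
    -- reaches `q` with `x` and `y` still at positions `i` and `k`.
    have key : ∀ {p q : S}, p ∈ U → f.eval (x p) ∈ Metric.ball (f.eval (x s)) ε →
        f.eval (x q) ∈ Metric.ball (f.eval (x s)) ε →
        Z (f.eval (x p)) a = x p → Z (f.eval (x p)) c = y p →
        Z (f.eval (x q)) a = x q → Z (f.eval (x q)) c = y q → P p → P q := by
      rintro p q hp hpb hqb hpa hpc hqa hqc ⟨z, hz, hzi, hzk⟩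
      obtain ⟨σ, rfl⟩ := exists_perm_of_labelledFibres hf (hZm _ hpb) hz.target_mem
      have hi : σ i = a := (hZm _ hpb).2.1 (hzi.trans hpa.symm)
      have hk : σ k = c := (hZm _ hpb).2.1 (hzk.trans hpc.symm)
      refine ⟨_, hz.trans (joinedIn_labelledFibres_of_section hZc hZm σ hpb hqb), ?_, ?_⟩
      · simp [hi, hqa]
      · simp [hk, hqc]
    filter_upwards [h1, h2, h3, self_mem_nhdsWithin] with r hr1 hr2 hr3 hr4
    rw [← hxy r hr4] at hr2
    have hs1 : Z (f.eval (x s)) a = x s := by rw [hZ0, ha]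
    have hs2 : Z (f.eval (x s)) c = y s := by rw [hZ0, hc]
    exact ⟨key hr4 hr3 hsb hr1 hr2 hs1 hs2, key hs hsb hr3 hs1 hs2 hr1 hr2⟩
  have hP : P s₁ ↔ P s₀ := hU.induction₂' (fun r s => P r ↔ P s)
    (fun s hs => (hloc s hs).mono fun r hr => ⟨hr.symm, hr⟩)
    (fun _ _ _ _ _ _ h h' => h.trans h') hs₁ hs₀
  exact hP.2 hP0

end Fibres

/-! ### Pairs of points in the fibres of z^(n+1) - c z^n -/

section TrinomialPairs

/-- The trinomial `z ^ (n + 1) - c * z ^ n`, all of whose ordered pairs of distinct points in a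
common fibre are parametrised by their ratio. -/
noncomputable def powMulSub (n : ℕ) (c : ℂ) : ℂ[X] := X ^ n * (X - C c)

theorem powMulSub_eval (n : ℕ) (c z : ℂ) : (powMulSub n c).eval z = z ^ n * (z - c) := by
  simp [powMulSub]

theorem powMulSub_natDegree (n : ℕ) (c : ℂ) : (powMulSub n c).natDegree = n + 1 := by
  rw [powMulSub, (monic_X_pow n).natDegree_mul (monic_X_sub_C c)]
  simp

theorem powMulSub_criticalValues {n : ℕ} (hn : 2 ≤ n) (c : ℂ) :
    criticalValues (powMulSub n c) =
      {0, (n * c / (n + 1)) ^ n * (n * c / (n + 1) - c)} := by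
  obtain ⟨k, rfl⟩ : ∃ k, n = k + 1 := ⟨n - 1, by omega⟩
  have hk : k ≠ 0 := by omega
  have hn0 : ((k + 1 : ℕ) : ℂ) + 1 ≠ 0 := by exact_mod_cast Nat.succ_ne_zero (k + 1)
  have hd : ∀ z, (powMulSub (k + 1) c).derivative.eval z =
      z ^ k * (((k + 1 : ℕ) + 1) * z - (k + 1 : ℕ) * c) := by
    intro z
    simp [powMulSub]
    ring
  ext t
  simp only [criticalValues, Set.mem_ofPred_eq, hd, powMulSub_eval, mul_eq_zero, pow_eq_zero_iff hk,
    Set.mem_insert_iff, Set.mem_singleton_iff]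
  constructor
  · rintro ⟨z, rfl | hz, rfl⟩
    · simp
    · right
      have : z = ((k + 1 : ℕ) : ℂ) * c / ((k + 1 : ℕ) + 1) := by
        rw [eq_div_iff hn0, mul_comm]
        exact sub_eq_zero.1 hz
      rw [this]
  · rintro (rfl | rfl)
    · exact ⟨0, Or.inl rfl, by simp⟩
    · refine ⟨_, Or.inr ?_, rfl⟩
      rw [mul_div_cancel₀ _ hn0, sub_self]

/-- All ordered pairs of distinct points of a common fibre of the trinomial over a regular value
lie in a single monodromy orbit. -/
theorem powMulSub_exists_joinedIn {n : ℕ} (hn : 2 ≤ n) {c : ℂ} (hc : c ≠ 0)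
    {b : ℂ × (Fin (powMulSub n c).natDegree → ℂ)} (hb : b ∈ labelledFibres (powMulSub n c))
    {i k : Fin (powMulSub n c).natDegree} (hik : i ≠ k) {x y : ℂ} (hxy : x ≠ y)
    (hf : (powMulSub n c).eval x = (powMulSub n c).eval y)
    (hreg : (powMulSub n c).eval x ∉ criticalValues (powMulSub n c)) :
    ∃ z, JoinedIn (labelledFibres (powMulSub n c)) b ((powMulSub n c).eval x, z) ∧
      z i = x ∧ z k = y := by
  have hdeg : 0 < (powMulSub n c).natDegree := by rw [powMulSub_natDegree]; omega
  have hn0 : n ≠ 0 := by omega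
  have hcrit0 : (0 : ℂ) ∈ criticalValues (powMulSub n c) := by
    rw [powMulSub_criticalValues hn]; simp
  -- Put y = s x in x^n (x - c) = y^n (y - c), cancel x^n and solve for x.
  let ξ : ℂ → ℂ := fun s => c * (1 - s ^ n) / (1 - s ^ (n + 1))
  let U : Set ℂ := {s | s ^ (n + 1) ≠ 1 ∧
    (powMulSub n c).eval (ξ s) ∉ criticalValues (powMulSub n c)}
  have hξ : ∀ s, s ^ (n + 1) ≠ 1 → ξ s * (1 - s ^ (n + 1)) = c * (1 - s ^ n) := fun s hs =>
    div_mul_cancel₀ _ (sub_ne_zero.2 (Ne.symm hs))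
  have hfin : Uᶜ.Finite := by
    have h1 : {s : ℂ | s ^ (n + 1) = 1}.Finite := by
      have hp : (X ^ (n + 1) - C 1 : ℂ[X]) ≠ 0 := X_pow_sub_C_ne_zero n.succ_pos 1
      refine ((X ^ (n + 1) - C 1 : ℂ[X]).rootSet_finite ℂ).subset fun s hs => ?_
      simp only [Set.mem_ofPred_eq] at hs
      rw [mem_rootSet]
      exact ⟨hp, by simp [hs]⟩
    have h2 : {x : ℂ | (powMulSub n c).eval x ∈ criticalValues (powMulSub n c)}.Finite := by
      refine (finite_criticalValues hdeg).preimage' fun v _ => ?_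
      have hp : powMulSub n c - C v ≠ 0 :=
        ne_zero_of_natDegree_gt (n := 0) (by rwa [natDegree_sub_C])
      refine ((powMulSub n c - C v).rootSet_finite ℂ).subset fun s hs => ?_
      rw [mem_rootSet]
      exact ⟨hp, by simpa [sub_eq_zero] using hs⟩
    have h3 : ∀ x : ℂ, {s : ℂ | x * (1 - s ^ (n + 1)) = c * (1 - s ^ n)}.Finite := by
      intro x
      -- The coefficient of X^n is c, which is nonzero, so each x is attained by finitely many
      -- ratios.
      have hp : (C x * (1 - X ^ (n + 1)) - C c * (1 - X ^ n) : ℂ[X]) ≠ 0 := by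
        intro h
        have := congrArg (fun p => coeff p n) h
        simp [coeff_X_pow, coeff_one, hn0, hc] at this
      refine (rootSet_finite (C x * (1 - X ^ (n + 1)) - C c * (1 - X ^ n) : ℂ[X]) ℂ).subset
        fun s hs => ?_
      rw [mem_rootSet]
      exact ⟨hp, by simpa [sub_eq_zero] using hs⟩
    refine (h1.union (h2.biUnion fun x _ => h3 x)).subset fun s hs => ?_
    by_cases hs1 : s ^ (n + 1) = 1
    · exact Or.inl hs1
    · refine Or.inr (Set.mem_biUnion (x := ξ s) ?_ (hξ s hs1))
      by_contra hcon
      exact hs ⟨hs1, hcon⟩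
  have hU : IsPreconnected U := by
    have := (hfin.countable.isPathConnected_compl_of_one_lt_rank (E := ℂ)
      (by rw [Complex.rank_real_complex]; norm_num)).isConnected.isPreconnected
    rwa [compl_compl] at this
  have hξc : ContinuousOn ξ U := by
    refine ContinuousOn.div (by fun_prop) (by fun_prop) fun s hs => ?_
    exact sub_ne_zero.2 (Ne.symm hs.1)
  have hpar : ∀ x y : ℂ, x ≠ y → (powMulSub n c).eval x = (powMulSub n c).eval y →
      (powMulSub n c).eval x ∉ criticalValues (powMulSub n c) →
      y / x ∈ U ∧ ξ (y / x) = x ∧ y / x * ξ (y / x) = y := by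
    intro x y hxy hf hreg
    have hx : x ≠ 0 := by
      rintro rfl
      apply hreg
      rw [powMulSub_eval, zero_pow hn0, zero_mul]
      exact hcrit0
    obtain ⟨s, rfl⟩ : ∃ s, y = s * x := ⟨y / x, (div_mul_cancel₀ y hx).symm⟩
    have hs1 : s ≠ 1 := by
      rintro rfl
      simp at hxy
    have hrel : x * (1 - s ^ (n + 1)) = c * (1 - s ^ n) := by
      rw [powMulSub_eval, powMulSub_eval, mul_pow] at hf
      refine mul_left_cancel₀ (pow_ne_zero n hx) ?_
      linear_combination hf
    -- If s^(n+1) = 1, the relation forces s^n = 1 because c ≠ 0, hence s = 1 and x = y.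
    have hsn : s ^ (n + 1) ≠ 1 := by
      intro h
      rw [h, sub_self, mul_zero, zero_eq_mul, or_iff_right hc] at hrel
      have h' : s ^ n = 1 := (sub_eq_zero.1 hrel).symm
      rw [pow_succ, h', one_mul] at h
      exact hs1 h
    have hξs : ξ s = x := by
      rw [← mul_left_inj' (sub_ne_zero.2 (Ne.symm hsn)), hξ s hsn, hrel]
    rw [mul_div_cancel_right₀ _ hx, hξs]
    exact ⟨⟨hsn, by rwa [hξs]⟩, rfl, rfl⟩
  have hb1 : (powMulSub n c).eval (b.2 i) = b.1 := hb.2.2 i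
  have hb2 : (powMulSub n c).eval (b.2 k) = b.1 := hb.2.2 k
  obtain ⟨hs0, hx0, hy0⟩ := hpar (b.2 i) (b.2 k) (fun h => hik (hb.2.1 h)) (hb1.trans hb2.symm)
    (by rw [hb1]; exact hb.1)
  obtain ⟨hs1, hx1, hy1⟩ := hpar x y hxy hf hreg
  have := exists_joinedIn_of_isPreconnected hdeg hU hξc (y := fun s => s * ξ s)
    (continuousOn_id.mul hξc) (fun s hs => ?_) (fun s hs => hs.2) i k hb hs0 hs1 hx0.symm hy0.symm
  · obtain ⟨z, h1, h2, h3⟩ := this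
    exact ⟨z, by rwa [hx1] at h1, h2.trans hx1, h3.trans hy1⟩
  · rw [powMulSub_eval, powMulSub_eval, mul_pow]
    linear_combination (ξ s) ^ n * hξ s hs.1

/-- The points of the 2-cycles of `z ↦ z ^ n + c` which are not fixed points give the double
points of the curve `(z ^ (n + 1) - c z ^ n, z ^ n + z)`. -/
theorem double_point_iff {n : ℕ} {c x y : ℂ} (hxy : x ≠ y) :
    (x ^ n * (x - c) = y ^ n * (y - c) ∧ x ^ n + x = y ^ n + y) ↔
      (y = x ^ n + c ∧ x = y ^ n + c) := by
  constructor
  · rintro ⟨h1, h2⟩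
    have h : (x - y) * (x ^ n + c - y) = 0 := by linear_combination h1 + (c - y) * h2
    have h' : x ^ n + c - y = 0 := (mul_eq_zero.1 h).resolve_left (sub_ne_zero.2 hxy)
    exact ⟨by linear_combination -h', by linear_combination h2 - h'⟩
  · rintro ⟨h1, h2⟩
    have e1 : x ^ n = y - c := by rw [h1]; ring
    have e2 : y ^ n = x - c := by rw [h2]; ring
    rw [e1, e2]
    exact ⟨by ring, by ring⟩

end TrinomialPairs


/-! ### Deforming the 2-cycles of z ↦ z^n and separating their values -/

section Perturbation

/-- The points of exact period two of `z ↦ z ^ n`, other than fixed points. -/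
noncomputable def powTwoCycles (n : ℕ) : Finset ℂ :=
  nthRootsFinset (n ^ 2 - 1) (1 : ℂ) \ nthRootsFinset (n - 1) (1 : ℂ)

theorem mem_powTwoCycles {n : ℕ} (hn : 2 ≤ n) {p : ℂ} :
    p ∈ powTwoCycles n ↔ p ^ (n ^ 2 - 1) = 1 ∧ p ^ (n - 1) ≠ 1 := by
  have h1 : 0 < n ^ 2 - 1 := by have : 2 ^ 2 ≤ n ^ 2 := Nat.pow_le_pow_left hn 2; omega
  rw [powTwoCycles, Finset.mem_sdiff, mem_nthRootsFinset h1, mem_nthRootsFinset (by omega)]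

theorem le_card_powTwoCycles {n : ℕ} (hn : 2 ≤ n) : n ^ 2 - n ≤ (powTwoCycles n).card := by
  have h1 : n ^ 2 - 1 ≠ 0 := by have : 2 ^ 2 ≤ n ^ 2 := Nat.pow_le_pow_left hn 2; omega
  have h2 : n - 1 ≠ 0 := by omega
  have := Finset.le_card_sdiff (nthRootsFinset (n - 1) (1 : ℂ)) (nthRootsFinset (n ^ 2 - 1) (1 : ℂ))
  rw [(Complex.isPrimitiveRoot_exp _ h1).card_nthRootsFinset,
    (Complex.isPrimitiveRoot_exp _ h2).card_nthRootsFinset] at this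
  refine le_trans ?_ this
  omega

theorem powTwoCycles_relations {n : ℕ} (hn : 2 ≤ n) {p : ℂ} (hp : p ∈ powTwoCycles n) :
    p ≠ 0 ∧ (p ^ n) ^ n = p ∧ p ^ n ≠ p := by
  rw [mem_powTwoCycles hn] at hp
  have h1 : n ^ 2 - 1 + 1 = n * n := by
    have : 2 ^ 2 ≤ n ^ 2 := Nat.pow_le_pow_left hn 2
    rw [← pow_two]; omega
  have hne : n ^ 2 - 1 ≠ 0 := by have : 2 ^ 2 ≤ n ^ 2 := Nat.pow_le_pow_left hn 2; omega
  have hp0 : p ≠ 0 := by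
    rintro rfl
    rw [zero_pow hne] at hp
    exact zero_ne_one hp.1
  refine ⟨hp0, ?_, fun h => hp.2 ?_⟩
  · rw [← pow_mul, ← h1, pow_succ, hp.1, one_mul]
  · have h3 : n - 1 + 1 = n := by omega
    rw [← h3, pow_succ] at h
    exact mul_right_cancel₀ hp0 (h.trans (one_mul p).symm)

/-- The points of period two of `z ↦ z ^ n` deform differentiably to `z ↦ z ^ n + c`. -/
theorem exists_twoCycle_deformation {n : ℕ} (hn : 2 ≤ n) {p : ℂ} (hp : p ∈ powTwoCycles n) :
    ∃ x : ℂ → ℂ, x 0 = p ∧ DifferentiableAt ℂ x 0 ∧ ∀ᶠ c in 𝓝 0, x c = (x c ^ n + c) ^ n + c := by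
  obtain ⟨hp0, hpp, -⟩ := powTwoCycles_relations hn hp
  let G : ℂ × ℂ → ℂ := fun u => (u.2 ^ n + u.1) ^ n + u.1 - u.2
  have hG : ContDiff ℂ 1 G := by fun_prop
  have hs : HasStrictFDerivAt G (fderiv ℂ G (0, p)) (0, p) :=
    hG.contDiffAt.hasStrictFDerivAt one_ne_zero
  have hG0 : G (0, p) = 0 := by simp [G, hpp]
  -- The derivative of w ↦ w^(n^2) - w at p is n^2 p^(n^2-1) - 1 = n^2 - 1, nonzero, so the implicit
  -- function theorem applies.
  have hpart : (fderiv ℂ G (0, p) ∘L .inr ℂ ℂ ℂ) 1 = (n : ℂ) ^ 2 - 1 := by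
    have h1 : HasDerivAt (fun w : ℂ => ((0 : ℂ), w)) (0, 1) p :=
      (hasDerivAt_const p (0 : ℂ)).prodMk (hasDerivAt_id p)
    have h2 := hs.hasFDerivAt.comp_hasDerivAt p h1
    have h3 : HasDerivAt (G ∘ fun w : ℂ => ((0 : ℂ), w)) ((n : ℂ) ^ 2 - 1) p := by
      have h4 : HasDerivAt (fun w : ℂ => w ^ (n * n) - w) (((n * n : ℕ) : ℂ) * p ^ (n * n - 1) - 1) p :=
        (hasDerivAt_pow (n * n) p).sub (hasDerivAt_id p)
      have h5 : p ^ (n * n - 1) = 1 := by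
        rw [← pow_two]; exact ((mem_powTwoCycles hn).1 hp).1
      rw [h5] at h4
      convert h4 using 1
      · funext w; simp [G, pow_mul]
      · push_cast; ring
    have := h2.unique h3
    simpa using this
  have hne : (n : ℂ) ^ 2 - 1 ≠ 0 := by
    rw [sub_ne_zero]
    have : 2 ^ 2 ≤ n ^ 2 := Nat.pow_le_pow_left hn 2
    exact_mod_cast (by omega : n ^ 2 ≠ 1)
  have hinv : (fderiv ℂ G (0, p) ∘L .inr ℂ ℂ ℂ).IsInvertible := by
    refine ⟨ContinuousLinearEquiv.unitsEquivAut ℂ (Units.mk0 _ hne), ?_⟩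
    ext
    rw [hpart]
    simp
  refine ⟨hs.implicitFunctionOfProdDomain hinv, ?_, ?_, ?_⟩
  · exact (hs.eventually_apply_eq_iff_implicitFunctionOfProdDomain hinv).self_of_nhds.1 rfl
  · exact (hs.hasStrictFDerivAt_implicitFunctionOfProdDomain hinv).differentiableAt
  · filter_upwards [hs.eventually_apply_implicitFunctionOfProdDomain hinv] with c hc
    rw [hG0] at hc
    exact (sub_eq_zero.1 hc).symm

/-- Differentiating y = x^n + c and x = y^n + c at c = 0 gives a linear system for x' and y'. The
resulting derivative of the value is symmetric in the two points of the cycle and depends only on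
their sum. -/
theorem hasDerivAt_twoCycle_value {n : ℕ} (hn : 2 ≤ n) {p : ℂ} (hp : p ∈ powTwoCycles n)
    {x : ℂ → ℂ} (hx0 : x 0 = p) (hx : DifferentiableAt ℂ x 0)
    (hcyc : ∀ᶠ c in 𝓝 0, x c = (x c ^ n + c) ^ n + c) :
    HasDerivAt (fun c => x c ^ n * (x c - c)) (-(n / (n - 1)) * (p + p ^ n)) 0 := by
  obtain ⟨hp0, hpp, -⟩ := powTwoCycles_relations hn hp
  obtain ⟨k, rfl⟩ : ∃ k, n = k + 1 := ⟨n - 1, by omega⟩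
  have hk : (k : ℂ) ≠ 0 := by exact_mod_cast (by omega : k ≠ 0)
  have hk2 : ((k + 1 : ℕ) : ℂ) - 1 ≠ 0 := by push_cast; simpa using hk
  have hdx := hx.hasDerivAt
  set α := deriv x 0
  have hdy : HasDerivAt (fun c => x c ^ (k + 1) + c) ((k + 1 : ℕ) * p ^ k * α + 1) 0 := by
    have := (hdx.fun_pow (k + 1)).fun_add (hasDerivAt_id 0)
    simpa [hx0] using this
  set β := ((k + 1 : ℕ) : ℂ) * p ^ k * α + 1 with hβ
  have hdx' : HasDerivAt x ((k + 1 : ℕ) * (p ^ (k + 1)) ^ k * β + 1) 0 := by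
    have := (hdy.fun_pow (k + 1)).fun_add (hasDerivAt_id 0)
    refine HasDerivAt.congr_of_eventuallyEq ?_ hcyc
    simpa [hx0] using this
  have hα : α = (k + 1 : ℕ) * (p ^ (k + 1)) ^ k * β + 1 := hdx.unique hdx'
  have ht := (hdx.fun_pow (k + 1)).fun_mul (hdx.fun_sub (hasDerivAt_id 0))
  refine ht.congr_deriv ?_
  simp only [id, hx0, Nat.add_sub_cancel, sub_zero]
  have hP : p ^ k * p = p ^ (k + 1) := (pow_succ p k).symm
  have hQ : (p ^ (k + 1)) ^ k * p ^ (k + 1) = p := by rw [← pow_succ, hpp]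
  push_cast at hα hβ ⊢
  rw [add_sub_cancel_right] at *
  generalize p ^ (k + 1) = q at *
  generalize p ^ k = P at *
  generalize q ^ k = Q at *
  -- Eliminate β; here k (k + 2) = n^2 - 1 and q = p^n.
  have hqα : k * (k + 2) * (q * α) = -((k + 1) * p + q) := by
    linear_combination (-q) * hα - (k + 1) * Q * q * hβ - (k + 1) * (1 + (k + 1) * P * α) * hQ
      - (k + 1) ^ 2 * α * hP
  field_simp
  linear_combination hqα + k * (k + 1) * α * hP

/-- For all small nonzero `c` the double points of `(z ^ (n + 1) - c z ^ n, z ^ n + z)` lie over at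
least `(n ^ 2 - n) / 2` regular values of the first coordinate. -/
theorem exists_many_double_values {n : ℕ} (hn : 2 ≤ n) :
    ∃ c : ℂ, c ≠ 0 ∧ ∃ T : Finset ℂ, n ^ 2 - n ≤ 2 * T.card ∧ ∀ t ∈ T,
      t ∉ criticalValues (powMulSub n c) ∧
      ∃ x y : ℂ, x ≠ y ∧ y = x ^ n + c ∧ x = y ^ n + c ∧ (powMulSub n c).eval x = t := by
  have hn0 : n ≠ 0 := by omega
  choose! x hx0 hxd hcyc using fun p (hp : p ∈ powTwoCycles n) => exists_twoCycle_deformation hn hp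
  let t : ℂ → ℂ → ℂ := fun p c => x p c ^ n * (x p c - c)
  have ht : ∀ p ∈ powTwoCycles n, HasDerivAt (t p) (-(n / (n - 1)) * (p + p ^ n)) 0 :=
    fun p hp => hasDerivAt_twoCycle_value hn hp (hx0 p hp) (hxd p hp) (hcyc p hp)
  have ht0 : ∀ p ∈ powTwoCycles n, t p 0 = p ^ n * p := fun p hp => by simp [t, hx0 p hp]
  have hA : ∀ p ∈ powTwoCycles n, ∀ᶠ c in 𝓝[≠] 0, x p c = (x p c ^ n + c) ^ n + c ∧
      x p c ≠ x p c ^ n + c ∧ t p c ∉ criticalValues (powMulSub n c) := by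
    intro p hp
    obtain ⟨hp0, hpp, hne⟩ := powTwoCycles_relations hn hp
    have hxc := (hxd p hp).continuousAt
    have htc := (ht p hp).continuousAt
    have htne : t p 0 ≠ 0 := by rw [ht0 p hp]; exact mul_ne_zero (pow_ne_zero _ hp0) hp0
    have h1 : ∀ᶠ c in 𝓝 0, x p c ≠ x p c ^ n + c := by
      refine (ContinuousAt.ne_iff_eventually_ne hxc (by fun_prop)).1 ?_
      simpa [hx0 p hp] using hne.symm
    have h2 : ∀ᶠ c in 𝓝 0, t p c ≠ 0 := htc.eventually_ne htne
    -- The nonzero critical value tends to 0 with c, while `t p c` tends to p^(n+1) ≠ 0.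
    have h3 : ∀ᶠ c in 𝓝 (0 : ℂ), t p c ≠ (n * c / (n + 1)) ^ n * (n * c / (n + 1) - c) := by
      refine (ContinuousAt.ne_iff_eventually_ne htc (by fun_prop)).1 ?_
      simpa using htne
    filter_upwards [nhdsWithin_le_nhds (hcyc p hp), nhdsWithin_le_nhds h1, nhdsWithin_le_nhds h2,
      nhdsWithin_le_nhds h3] with c h0 h1 h2 h3
    refine ⟨h0, h1, ?_⟩
    rw [powMulSub_criticalValues hn]
    simp [h2, h3]
  have hB : ∀ p ∈ powTwoCycles n, ∀ q ∈ powTwoCycles n, ∀ᶠ c in 𝓝[≠] 0,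
      q ≠ p → q ≠ p ^ n → t p c ≠ t q c := by
    intro p hp q hq
    by_cases hqp : q ≠ p ∧ q ≠ p ^ n
    swap
    · exact Eventually.of_forall fun c h1 h2 => absurd ⟨h1, h2⟩ hqp
    suffices ∀ᶠ c in 𝓝[≠] 0, t p c ≠ t q c from this.mono fun c h _ _ => h
    -- Values equal at c = 0 mean equal products p p^n = q q^n. Equal derivatives would also make
    -- the sums equal, and then q would be a root of (w - p)(w - p^n).
    by_cases h0 : t p 0 = t q 0
    · have hd := (ht p hp).fun_sub (ht q hq)
      have hd0 : -((n : ℂ) / (n - 1)) * (p + p ^ n) - -(n / (n - 1)) * (q + q ^ n) ≠ 0 := by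
        intro h
        have hc : (n : ℂ) / (n - 1) ≠ 0 := by
          refine div_ne_zero (by exact_mod_cast hn0) (sub_ne_zero.2 ?_)
          exact_mod_cast (by omega : n ≠ 1)
        have hsum : p + p ^ n = q + q ^ n := by
          refine mul_left_cancel₀ hc ?_
          linear_combination -h
        rw [ht0 p hp, ht0 q hq] at h0
        have : (q - p) * (q - p ^ n) = 0 := by linear_combination h0 - q * hsum
        rcases mul_eq_zero.1 this with h | h
        · exact hqp.1 (sub_eq_zero.1 h)
        · exact hqp.2 (sub_eq_zero.1 h)
      filter_upwards [hd.eventually_ne (c := 0) hd0] with c hc h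
      exact hc (sub_eq_zero.2 h)
    · exact nhdsWithin_le_nhds
        ((ContinuousAt.ne_iff_eventually_ne (ht p hp).continuousAt (ht q hq).continuousAt).1 h0)
  obtain ⟨c, hcA, hcB, hc0⟩ := (((eventually_all_finset _).2 hA).and
    (((eventually_all_finset _).2 fun p hp => (eventually_all_finset _).2 (hB p hp)).and
      self_mem_nhdsWithin)).exists
  refine ⟨c, hc0, (powTwoCycles n).image (t · c), ?_, ?_⟩
  · refine (le_card_powTwoCycles hn).trans ?_
    -- Only the two points p and p^n of one cycle can share a value.
    refine Finset.card_le_mul_card_image _ 2 fun v hv => ?_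
    obtain ⟨p, hp, rfl⟩ := Finset.mem_image.1 hv
    refine (Finset.card_le_card (t := {p, p ^ n}) fun q hq => ?_).trans Finset.card_le_two
    obtain ⟨hq, hqt⟩ := Finset.mem_filter.1 hq
    by_contra hcon
    rw [Finset.mem_insert, Finset.mem_singleton, not_or] at hcon
    exact hcB p hp q hq hcon.1 hcon.2 hqt.symm
  · intro v hv
    obtain ⟨p, hp, rfl⟩ := Finset.mem_image.1 hv
    obtain ⟨h1, h2, h3⟩ := hcA p hp
    exact ⟨h3, x p c, x p c ^ n + c, h2, rfl, h1, powMulSub_eval n c _⟩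

end Perturbation

/-! ### Many zeros for one simple cycle; bounds on the dimension -/

section LowerBound

namespace ZeroCycle

theorem melnikov_apply {f : ℂ[X]} (C : ZeroCycle f) (g : ℂ[X]) (p : C.branches) :
    C.melnikov g p = -∑ j, (C.weight j : ℂ) * g.eval (p.1.2 j) := rfl

theorem sum_single_sub_single_mul {ι : Type*} [Fintype ι] [DecidableEq ι] (i k : ι) (v : ι → ℂ) :
    ∑ j, (((Pi.single k 1 - Pi.single i 1 : ι → ℤ) j : ℤ) : ℂ) * v j = v k - v i := by
  simp [Pi.single_apply, sub_mul, Finset.sum_sub_distrib]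

theorem exists_simple {f : ℂ[X]} {t : ℂ} {z : Fin f.natDegree → ℂ} (h : (t, z) ∈ labelledFibres f)
    {i k : Fin f.natDegree} (hik : i ≠ k) :
    ∃ C : ZeroCycle f, C.IsSimple ∧ C.base = t ∧ C.root = z ∧
      C.weight = Pi.single k 1 - Pi.single i 1 :=
  ⟨⟨t, z, h, Pi.single k 1 - Pi.single i 1, by simp⟩, ⟨i, k, hik, rfl⟩, rfl, rfl, rfl⟩

end ZeroCycle

theorem exists_simple_cycle_many_zeros {n : ℕ} (hn : 2 ≤ n) :
    ∃ (f g : ℂ[X]) (C : ZeroCycle f), f.natDegree = n + 1 ∧ g.natDegree = n ∧ C.IsSimple ∧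
      ((n ^ 2 - n : ℕ) : ℕ∞) ≤ 2 * C.numZeros g := by
  obtain ⟨c, hc, T, hT, hTz⟩ := exists_many_double_values hn
  have hn0 : n ≠ 0 := by omega
  have hdeg := powMulSub_natDegree n c
  have hdeg0 : 0 < (powMulSub n c).natDegree := by omega
  obtain ⟨b, hb⟩ := (finite_criticalValues hdeg0).infinite_compl.nonempty
  obtain ⟨z, hz⟩ := exists_labelledFibres hdeg0 hb
  have hik : (⟨0, by omega⟩ : Fin (powMulSub n c).natDegree) ≠ ⟨1, by omega⟩ := by simp
  generalize (⟨0, by omega⟩ : Fin (powMulSub n c).natDegree) = i at hik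
  generalize (⟨1, by omega⟩ : Fin (powMulSub n c).natDegree) = k at hik
  obtain ⟨C, hC, rfl, rfl, hw⟩ := ZeroCycle.exists_simple hz hik
  have hgdeg : (X ^ n + X : ℂ[X]).natDegree = n := by
    rw [natDegree_add_eq_left_of_natDegree_lt] <;> simp
    omega
  refine ⟨_, X ^ n + X, C, hdeg, hgdeg, hC, ?_⟩
  have hmel : ∀ p : C.branches, C.melnikov (X ^ n + X) p = 0 ↔
      p.1.2 i ^ n + p.1.2 i = p.1.2 k ^ n + p.1.2 k := by
    intro p
    rw [ZeroCycle.melnikov_apply, hw,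
      ZeroCycle.sum_single_sub_single_mul i k fun j => (X ^ n + X : ℂ[X]).eval (p.1.2 j)]
    rw [neg_eq_zero, sub_eq_zero, eq_comm]
    simp
  have hsub : ↑T ⊆ C.zeroSet (X ^ n + X) := by
    intro t ht
    obtain ⟨hreg, x, y, hxy, hy, hx, rfl⟩ := hTz t ht
    have hd := (double_point_iff hxy).2 ⟨hy, hx⟩
    obtain ⟨w, hjoin, rfl, rfl⟩ := powMulSub_exists_joinedIn hn hc C.mem_fibres hik hxy
      (by rw [powMulSub_eval, powMulSub_eval, hd.1]) hreg
    exact ⟨⟨_, hjoin⟩, rfl, (hmel _).2 hd.2⟩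
  -- Only isolated zeros are counted. Every zero comes from a root of (x^n + c)^n + c - x, so the
  -- zero set is finite and all its points are isolated.
  have hfin : (C.zeroSet (X ^ n + X)).Finite := by
    have hp : ((X ^ n + Polynomial.C c) ^ n + Polynomial.C c - X : ℂ[X]) ≠ 0 := by
      have h1 : (X ^ n + Polynomial.C c : ℂ[X]).Monic := monic_X_pow_add_C c hn0
      refine ne_zero_of_natDegree_gt (n := 0) ?_
      have h2 : ((X ^ n + Polynomial.C c : ℂ[X]) ^ n).natDegree = n * n := by
        rw [h1.natDegree_pow, natDegree_X_pow_add_C]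
      have h3 : 2 * 2 ≤ n * n := Nat.mul_le_mul hn hn
      rw [natDegree_sub_eq_left_of_natDegree_lt, natDegree_add_C, h2]
      · omega
      · rw [natDegree_add_C, h2, natDegree_X]
        omega
    refine ((rootSet_finite ((X ^ n + Polynomial.C c) ^ n + Polynomial.C c - X : ℂ[X]) ℂ).image
      fun x => (powMulSub n c).eval x).subset ?_
    rintro t ⟨p, rfl, hp0⟩
    have hmem := JoinedIn.target_mem p.2
    have hne : p.1.2 i ≠ p.1.2 k := fun h => hik (hmem.2.1 h)
    have hfi : (powMulSub n c).eval (p.1.2 i) = p.1.1 := hmem.2.2 i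
    have hfk : (powMulSub n c).eval (p.1.2 k) = p.1.1 := hmem.2.2 k
    refine ⟨p.1.2 i, ?_, hfi⟩
    rw [← hfk, powMulSub_eval, powMulSub_eval] at hfi
    obtain ⟨h1, h2⟩ := (double_point_iff hne).1 ⟨hfi, (hmel p).1 hp0⟩
    rw [mem_rootSet]
    refine ⟨hp, ?_⟩
    rw [h1] at h2
    simp [← h2]
  have hnum : C.numZeros (X ^ n + X) = (C.zeroSet (X ^ n + X)).encard := by
    rw [ZeroCycle.numZeros]
    congr 1
    ext t
    refine and_iff_left_of_imp fun _ => ?_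
    have := (hfin.subset (Set.sdiff_subset (t := {t}))).isClosed.isOpen_compl.eventually_mem
      (x := t) (by simp)
    filter_upwards [nhdsWithin_le_nhds this, self_mem_nhdsWithin] with s hs hst hmem
    exact hs ⟨hmem, hst⟩
  rw [hnum]
  calc ((n ^ 2 - n : ℕ) : ℕ∞) ≤ ((2 * T.card : ℕ) : ℕ∞) := by exact_mod_cast hT
    _ = 2 * (T : Set ℂ).encard := by rw [Set.encard_coe_eq_coe_finsetCard]; push_cast; rfl
    _ ≤ _ := by gcongr

/-- The integral of g = z along a simple cycle is a difference of distinct roots, hence nonzero. -/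
theorem exists_simple_cycle_dimIntegrals_pos {m : ℕ} (hm : 2 ≤ m) :
    ∃ (f : ℂ[X]) (C : ZeroCycle f), f.natDegree = m ∧ C.IsSimple ∧
      C.dimIntegrals (m - 1) ≠ 0 := by
  have hdeg : (X ^ m : ℂ[X]).natDegree = m := natDegree_X_pow m
  have hdeg0 : 0 < (X ^ m : ℂ[X]).natDegree := by omega
  obtain ⟨b, hb⟩ := (finite_criticalValues hdeg0).infinite_compl.nonempty
  obtain ⟨z, hz⟩ := exists_labelledFibres hdeg0 hb
  have hik : (⟨0, by omega⟩ : Fin (X ^ m : ℂ[X]).natDegree) ≠ ⟨1, by omega⟩ := by simp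
  generalize (⟨0, by omega⟩ : Fin (X ^ m : ℂ[X]).natDegree) = i at hik
  generalize (⟨1, by omega⟩ : Fin (X ^ m : ℂ[X]).natDegree) = k at hik
  obtain ⟨C, hC, rfl, rfl, hw⟩ := ZeroCycle.exists_simple hz hik
  refine ⟨_, C, hdeg, hC, fun h => ?_⟩
  have hmem : C.abelianIntegral X ∈ C.integralSpace (m - 1) := by
    refine Submodule.mem_map_of_mem (mem_degreeLE.2 ?_)
    rw [degree_X]
    exact_mod_cast (by omega : 1 ≤ m - 1)
  -- `finrank` is 0 by default in infinite dimension, so finiteness is needed to read `finrank = 0`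
  -- as triviality.
  have : Module.Finite ℂ (degreeLE ℂ ((m - 1 : ℕ) : WithBot ℕ)) := by
    rw [degreeLE_eq_span_X_pow]
    exact Module.Finite.span_of_finite ℂ (Finset.finite_toSet _)
  have : Module.Finite ℂ (C.integralSpace (m - 1)) := by
    rw [ZeroCycle.integralSpace]; infer_instance
  rw [ZeroCycle.dimIntegrals, Module.finrank_eq_zero_iff_of_free,
    Submodule.subsingleton_iff_eq_bot] at h
  rw [h, Submodule.mem_bot] at hmem
  have := congrFun hmem ⟨_, JoinedIn.refl C.mem_fibres⟩
  simp only [ZeroCycle.abelianIntegral, LinearMap.coe_mk, AddHom.coe_mk, eval_X, Pi.zero_apply, hw,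
    ZeroCycle.sum_single_sub_single_mul i k, sub_eq_zero] at this
  exact hik (C.mem_fibres.2.1 this.symm)

theorem ZeroCycle.dimIntegrals_le {f : ℂ[X]} (C : ZeroCycle f) (n : ℕ) :
    C.dimIntegrals n ≤ n + 1 := by
  have h := degreeLE_eq_span_X_pow (R := ℂ) (n := n)
  have : Module.Finite ℂ (degreeLE ℂ (n : WithBot ℕ)) := by
    rw [h]
    exact Module.Finite.span_of_finite ℂ (Finset.finite_toSet _)
  refine (Submodule.finrank_map_le C.abelianIntegral (degreeLE ℂ (n : WithBot ℕ))).trans ?_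
  rw [h]
  exact (finrank_span_finset_le_card _).trans (Finset.card_image_le.trans (by simp))

end LowerBound

/-! ### Upper bound for the number of isolated zeros -/

section Finiteness

/-- A polynomial growing at most like the `N`-th power has degree at most `N`. -/
theorem natDegree_le_of_norm_eval_le {q : ℂ[X]} {B : ℝ} {N : ℕ}
    (h : ∀ᶠ t in Bornology.cobounded ℂ, ‖q.eval t‖ ≤ B * (1 + ‖t‖) ^ N) : q.natDegree ≤ N := by
  by_contra! hN
  have hq : q ≠ 0 := ne_zero_of_natDegree_gt hN
  -- `q.reverse` at 1/t is q(t)/t^deg q. It tends to the leading coefficient, yet is O(1/|t|) if deg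
  -- q > N.
  have h1 : Tendsto (fun t : ℂ => q.reverse.eval t⁻¹) (Bornology.cobounded ℂ)
      (𝓝 (q.reverse.eval 0)) :=
    (q.reverse.continuous.tendsto 0).comp tendsto_inv₀_cobounded
  have h2 : Tendsto (fun t : ℂ => q.reverse.eval t⁻¹) (Bornology.cobounded ℂ) (𝓝 0) := by
    have hinv : Tendsto (fun t : ℂ => |B| * 2 ^ N * ‖t‖⁻¹) (Bornology.cobounded ℂ) (𝓝 0) := by
      simpa using (tendsto_norm_cobounded_atTop (E := ℂ)).inv_tendsto_atTop.const_mul (|B| * 2 ^ N)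
    refine squeeze_zero_norm' ?_ hinv
    filter_upwards [h, tendsto_norm_cobounded_atTop.eventually_ge_atTop 1] with t ht ht1
    have ht0 : t ≠ 0 := by rintro rfl; norm_num at ht1
    have hrev : q.reverse.eval t⁻¹ * t ^ q.natDegree = q.eval t := by
      let _ := invertibleOfNonzero ht0
      have := eval₂_reverse_mul_pow (RingHom.id ℂ) t q
      simpa [eval₂_id] using this
    obtain ⟨k, hk⟩ : ∃ k, q.natDegree = N + 1 + k := ⟨q.natDegree - (N + 1), by omega⟩
    have hpos : 0 < ‖t‖ := by linarith
    rw [← div_eq_mul_inv, le_div_iff₀ hpos]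
    refine le_of_mul_le_mul_right ?_ (pow_pos hpos N)
    calc ‖q.reverse.eval t⁻¹‖ * ‖t‖ * ‖t‖ ^ N
        ≤ ‖q.reverse.eval t⁻¹‖ * ‖t‖ * ‖t‖ ^ N * ‖t‖ ^ k :=
          le_mul_of_one_le_right (by positivity) (one_le_pow₀ ht1)
      _ = ‖q.eval t‖ := by rw [← hrev, norm_mul, norm_pow, hk]; ring
      _ ≤ B * (1 + ‖t‖) ^ N := ht
      _ ≤ |B| * (2 * ‖t‖) ^ N := by
          gcongr
          · exact le_abs_self B
          · linarith
      _ = |B| * 2 ^ N * ‖t‖ ^ N := by rw [mul_pow]; ring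
  have h3 := tendsto_nhds_unique h1 h2
  rw [← coeff_zero_eq_eval_zero, coeff_zero_reverse, leadingCoeff_eq_zero] at h3
  exact hq h3

/-- Cauchy's root bound for f - t is affine in |t|: the leading coefficient does not depend on t. -/
theorem exists_norm_le_of_eval_eq {f : ℂ[X]} (hf : 0 < f.natDegree) :
    ∃ K : ℝ, ∀ t z : ℂ, f.eval z = t → 1 + ‖z‖ ≤ K * (1 + ‖t‖) := by
  have hlc : 0 < ‖f.leadingCoeff‖ := norm_pos_iff.2 (leadingCoeff_ne_zero.2 (ne_zero_of_natDegree_gt hf))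
  set A : NNReal := ∑ i ∈ Finset.range f.natDegree, ‖f.coeff i‖₊
  refine ⟨(A + 1) / ‖f.leadingCoeff‖ + 2, fun t z hz => ?_⟩
  have hdeg : (f - C t).natDegree = f.natDegree := natDegree_sub_C
  have hf0 : f - C t ≠ 0 := ne_zero_of_natDegree_gt (hdeg ▸ hf)
  have hroot : (f - C t).IsRoot z := by simp [hz]
  have h1 := hroot.norm_lt_cauchyBound hf0
  have h2 : (f - C t).leadingCoeff = f.leadingCoeff := by
    rw [leadingCoeff, coeff_sub, hdeg, coeff_C_of_ne_zero hf.ne', sub_zero, leadingCoeff]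
  have h3 : (Finset.range (f - C t).natDegree).sup (‖(f - C t).coeff ·‖₊) ≤ A + ‖t‖₊ := by
    refine Finset.sup_le fun i hi => ?_
    rw [hdeg] at hi
    rw [coeff_sub]
    refine (nnnorm_sub_le _ _).trans (add_le_add ?_ ?_)
    · exact Finset.single_le_sum (f := fun i => ‖f.coeff i‖₊) (fun _ _ => zero_le) hi
    · rw [coeff_C]
      split_ifs <;> simp
  have h4 : ‖z‖ ≤ (A + ‖t‖) / ‖f.leadingCoeff‖ + 1 := by
    have : (cauchyBound (f - C t) : ℝ) ≤ (A + ‖t‖) / ‖f.leadingCoeff‖ + 1 := by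
      rw [cauchyBound, h2]
      push_cast
      gcongr
      exact_mod_cast h3
    exact (NNReal.coe_le_coe.2 h1.le).trans this
  have h5 : (A + ‖t‖) / ‖f.leadingCoeff‖ ≤ (A + 1) / ‖f.leadingCoeff‖ * (1 + ‖t‖) := by
    rw [div_mul_eq_mul_div]
    gcongr
    nlinarith [norm_nonneg t, A.coe_nonneg, mul_nonneg A.coe_nonneg (norm_nonneg t)]
  nlinarith [norm_nonneg t]

theorem exists_norm_eval_le {g : ℂ[X]} {n : ℕ} (hg : g.natDegree ≤ n) :
    ∃ K : ℝ, ∀ z : ℂ, ‖g.eval z‖ ≤ K * (1 + ‖z‖) ^ n := by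
  refine ⟨∑ i ∈ Finset.range (n + 1), ‖g.coeff i‖, fun z => ?_⟩
  rw [eval_eq_sum_range' (Nat.lt_succ_of_le hg), Finset.sum_mul]
  refine (norm_sum_le _ _).trans (Finset.sum_le_sum fun i hi => ?_)
  rw [norm_mul, norm_pow]
  gcongr
  have h1 : ‖z‖ ^ i ≤ (1 + ‖z‖) ^ i := by gcongr; linarith
  exact h1.trans (pow_le_pow_right₀ (by linarith [norm_nonneg z])
    (Nat.lt_succ_iff.1 (Finset.mem_range.1 hi)))

/-- Symmetric functions of the points of a fibre over `t` are polynomials in `t`. -/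
theorem exists_eval_eq_of_isSymmetric {f : ℂ[X]} (hf : 0 < f.natDegree)
    {S : MvPolynomial (Fin f.natDegree) ℂ} (hS : S.IsSymmetric) :
    ∃ q : ℂ[X], ∀ p ∈ labelledFibres f, q.eval p.1 = MvPolynomial.aeval p.2 S := by
  have hlc : f.leadingCoeff ≠ 0 := leadingCoeff_ne_zero.2 (ne_zero_of_natDegree_gt hf)
  have hes : ∀ i : Fin f.natDegree, ∃ c : ℂ[X], ∀ p ∈ labelledFibres f,
      c.eval p.1 = MvPolynomial.aeval p.2 (MvPolynomial.esymm (Fin f.natDegree) ℂ (i + 1)) := by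
    intro i
    let k := f.natDegree - (i + 1)
    have hk : f.natDegree - k = i + 1 := by have := i.2; omega
    -- Vieta for f - t; only the constant coefficient, k = 0, involves t.
    refine ⟨C ((-1) ^ (i + 1 : ℕ) / f.leadingCoeff) * (C (f.coeff k) - if k = 0 then X else 0), ?_⟩
    rintro ⟨t, z⟩ hz
    have h1 := congrArg (coeff · k) (sub_C_eq_prod_of_labelledFibres hf hz)
    have h2 := Multiset.prod_X_sub_C_coeff (Finset.univ.val.map z) (k := k) (by simp [k])
    simp only [Multiset.card_map, Finset.card_val, Finset.card_univ, Fintype.card_fin, hk,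
      Multiset.map_map, Function.comp_def] at h2
    rw [MvPolynomial.aeval_esymm_eq_multiset_esymm]
    have h3 : (∏ j, (X - C (z j))).coeff k =
        (-1) ^ (i + 1 : ℕ) * (Finset.univ.val.map z).esymm (i + 1) := h2
    simp only [coeff_sub, coeff_C_mul, h3] at h1
    have h4 : eval t (C (f.coeff k) - if k = 0 then X else 0) = f.coeff k - (C t).coeff k := by
      rw [coeff_C]
      split_ifs <;> simp
    rw [eval_mul, eval_C, h4, h1]
    have h5 : ((-1 : ℂ) ^ (i + 1 : ℕ)) * (-1) ^ (i + 1 : ℕ) = 1 := by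
      rw [← mul_pow]; simp
    field_simp
    linear_combination ((Finset.univ.val.map z).esymm (i + 1)) * h5
  choose c hc using hes
  obtain ⟨P, hP⟩ := MvPolynomial.esymmAlgHom_surjective (σ := Fin f.natDegree) ℂ
    (n := f.natDegree) (by simp) ⟨S, hS⟩
  have hP' : MvPolynomial.aeval
      (fun i : Fin f.natDegree => MvPolynomial.esymm (Fin f.natDegree) ℂ (i + 1)) P = S := by
    rw [← MvPolynomial.esymmAlgHom_apply, hP]
  refine ⟨MvPolynomial.aeval c P, fun p hp => ?_⟩
  rw [← hP', ← coe_aeval_eq_eval, MvPolynomial.comp_aeval_apply, MvPolynomial.comp_aeval_apply]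
  congr 2
  funext i
  rw [coe_aeval_eq_eval]
  exact hc i p hp

/-- The elementary symmetric functions of the branches `∑ n_j g(z_{σ j})`, where `σ` runs over all
permutations, are polynomials in `t`. -/
theorem exists_eval_eq_sum_powersetCard {f : ℂ[X]} (hf : 0 < f.natDegree)
    (w : Fin f.natDegree → ℂ) (g : ℂ[X]) (r : ℕ) :
    ∃ q : ℂ[X], ∀ p ∈ labelledFibres f, q.eval p.1 =
      ∑ T ∈ Finset.univ.powersetCard r, ∏ σ ∈ T,
        ∑ j, w j * g.eval (p.2 ((σ : Equiv.Perm (Fin f.natDegree)) j)) := by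
  let I : Equiv.Perm (Fin f.natDegree) → MvPolynomial (Fin f.natDegree) ℂ := fun σ =>
    ∑ j, MvPolynomial.C (w j) * aeval (MvPolynomial.X (σ j)) g
  let S := MvPolynomial.aeval I (MvPolynomial.esymm (Equiv.Perm (Fin f.natDegree)) ℂ r)
  -- Renaming the variables by τ permutes the branches by left multiplication, so a symmetric
  -- function of the branches is symmetric in the roots.
  have hI : ∀ τ : Equiv.Perm (Fin f.natDegree),
      (fun σ => MvPolynomial.rename τ (I σ)) = I ∘ Equiv.mulLeft τ := by
    intro τ
    funext σ
    simp only [I, map_sum, map_mul, MvPolynomial.rename_C, MvPolynomial.rename_X,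
      Function.comp_apply, ← Polynomial.aeval_algHom_apply, Equiv.coe_mulLeft, Equiv.Perm.coe_mul]
  have hS : S.IsSymmetric := by
    intro τ
    have h := MvPolynomial.esymm_isSymmetric (Equiv.Perm (Fin f.natDegree)) ℂ r (Equiv.mulLeft τ)
    rw [MvPolynomial.comp_aeval_apply, hI, ← MvPolynomial.aeval_rename, h]
  obtain ⟨q, hq⟩ := exists_eval_eq_of_isSymmetric hf hS
  refine ⟨q, fun p hp => ?_⟩
  have hev : ∀ σ, MvPolynomial.aeval p.2 (I σ) = ∑ j, w j * g.eval (p.2 (σ j)) := by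
    intro σ
    simp only [I, map_sum, map_mul, MvPolynomial.aeval_C, Algebra.algebraMap_self, RingHom.id_apply,
      ← Polynomial.aeval_algHom_apply, MvPolynomial.aeval_X, coe_aeval_eq_eval]
  rw [hq p hp, MvPolynomial.comp_aeval_apply]
  simp only [MvPolynomial.esymm, map_sum, map_prod, MvPolynomial.aeval_X, hev]

/-- Let e_r be the last symmetric function of the permuted branches that is not identically zero. At
most r branches are nonzero over any regular t. If e_r(t) ≠ 0, some r branches are nonzero near t,
so a branch vanishing at t vanishes identically nearby and its zero is not isolated. Roots grow at
most linearly in |t|, hence deg e_r ≤ n r. -/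
theorem ZeroCycle.numZeros_le {f : ℂ[X]} (hf : 0 < f.natDegree) (C : ZeroCycle f) {g : ℂ[X]}
    {n : ℕ} (hg : g.natDegree ≤ n) :
    C.numZeros g ≤ ((n * f.natDegree.factorial : ℕ) : ℕ∞) := by
  let I : (Fin f.natDegree → ℂ) → Equiv.Perm (Fin f.natDegree) → ℂ := fun z σ =>
    ∑ j, (C.weight j : ℂ) * g.eval (z (σ j))
  have hcard : Fintype.card (Equiv.Perm (Fin f.natDegree)) = f.natDegree.factorial := by
    rw [Fintype.card_perm, Fintype.card_fin]
  choose q hq using exists_eval_eq_sum_powersetCard hf (fun j => (C.weight j : ℂ)) g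
  have hq' : ∀ r, ∀ p ∈ labelledFibres f,
      (q r).eval p.1 = ∑ T ∈ Finset.univ.powersetCard r, ∏ σ ∈ T, I p.2 σ := hq
  have hq0 : q 0 ≠ 0 := by
    intro h
    have := hq' 0 _ C.mem_fibres
    simp [h] at this
  classical
  set r := Nat.findGreatest (fun r => q r ≠ 0) f.natDegree.factorial with hr
  have hr1 : q r ≠ 0 := Nat.findGreatest_spec (P := fun r => q r ≠ 0) (zero_le) hq0
  have hr2 : r ≤ f.natDegree.factorial := Nat.findGreatest_le _
  have hr3 : ∀ s, r < s → s ≤ f.natDegree.factorial → q s = 0 := fun s h1 h2 =>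
    not_not.1 (Nat.findGreatest_is_greatest h1 h2)
  have hdeg : (q r).natDegree ≤ n * f.natDegree.factorial := by
    obtain ⟨K, hK⟩ := exists_norm_le_of_eval_eq hf
    obtain ⟨G, hG⟩ := exists_norm_eval_le hg
    let W : ℝ := ∑ j, ‖(C.weight j : ℂ)‖ * (|G| * K ^ n)
    refine (natDegree_le_of_norm_eval_le
      (B := ∑ T ∈ (Finset.univ : Finset (Equiv.Perm (Fin f.natDegree))).powersetCard r, W ^ r)
      (N := n * r) ?_).trans (Nat.mul_le_mul_left n hr2)
    have hcob : ∀ᶠ t in Bornology.cobounded ℂ, t ∉ criticalValues f :=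
      Bornology.isBounded_def.1 (finite_criticalValues hf).isBounded
    filter_upwards [hcob] with t ht
    obtain ⟨z, hz⟩ := exists_labelledFibres hf ht
    rw [hq' r _ hz, Finset.sum_mul]
    refine (norm_sum_le _ _).trans (Finset.sum_le_sum fun T hT => ?_)
    have hI : ∀ σ, ‖I z σ‖ ≤ W * (1 + ‖t‖) ^ n := by
      intro σ
      simp only [I, W]
      rw [Finset.sum_mul]
      refine (norm_sum_le _ _).trans (Finset.sum_le_sum fun j _ => ?_)
      rw [norm_mul, mul_assoc, mul_assoc, ← mul_pow]
      gcongr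
      calc ‖g.eval (z (σ j))‖ ≤ G * (1 + ‖z (σ j)‖) ^ n := hG _
        _ ≤ |G| * (K * (1 + ‖t‖)) ^ n := by
          gcongr
          · exact le_abs_self G
          · exact hK _ _ (hz.2.2 (σ j))
    rw [norm_prod, pow_mul, ← mul_pow, ← (Finset.mem_powersetCard.1 hT).2]
    exact (Finset.prod_le_prod (fun _ _ => norm_nonneg _) fun σ _ => hI σ).trans_eq (by simp)
  have hsub : {t | t ∈ C.zeroSet g ∧ ∀ᶠ s in 𝓝[≠] t, s ∉ C.zeroSet g} ⊆
      ((q r).roots.toFinset : Set ℂ) := by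
    rintro t ⟨⟨⟨⟨t, z⟩, hp⟩, rfl, hp0⟩, hiso⟩
    simp only [Finset.mem_coe, Multiset.mem_toFinset, mem_roots hr1, IsRoot]
    by_contra hne
    have hz : (t, z) ∈ labelledFibres f := JoinedIn.target_mem hp
    rw [hq' r _ hz] at hne
    obtain ⟨T, hT, hT0⟩ := Finset.exists_ne_zero_of_sum_ne_zero hne
    rw [Finset.mem_powersetCard] at hT
    have hI1 : I z 1 = 0 := neg_eq_zero.1 hp0
    have h1T : 1 ∉ T := fun h => hT0 (Finset.prod_eq_zero h hI1)
    obtain ⟨Z, ε, hε, hZ0, hZc, hZm, -⟩ := exists_local_section hf hz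
    have htb : t ∈ Metric.ball t ε := Metric.mem_ball_self hε
    have hZt : ContinuousAt Z t := hZc.continuousAt (Metric.ball_mem_nhds t hε)
    have hZj : ∀ j, ContinuousAt (fun s => Z s j) t := fun j => continuousAt_pi.1 hZt j
    have hcont : ContinuousAt (fun s => ∏ σ ∈ T, I (Z s) σ) t := by
      refine tendsto_finsetProd _ fun σ _ => tendsto_finsetSum _ fun j _ => ?_
      exact (g.continuous.continuousAt.comp (hZj (σ j))).const_mul _
    have hnear : ∀ᶠ s in 𝓝 t, s ∈ C.zeroSet g := by
      filter_upwards [Metric.ball_mem_nhds t hε, hcont.eventually_ne (by rw [hZ0]; exact hT0)]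
        with s hs hsT
      have hjoin : JoinedIn (labelledFibres f) (C.base, C.root) (s, Z s) := by
        have := joinedIn_labelledFibres_of_section hZc hZm 1 htb hs
        rw [hZ0] at this
        exact JoinedIn.trans hp this
      refine ⟨⟨(s, Z s), hjoin⟩, rfl, neg_eq_zero.2 ?_⟩
      by_contra hI
      have hI' : I (Z s) 1 ≠ 0 := hI
      -- With exactly |N| nonzero branches, the symmetric function of index |N| is the single
      -- product over `N`, which is nonzero although |N| > r.
      let N := Finset.univ.filter fun σ => I (Z s) σ ≠ 0
      have hTN : insert 1 T ⊆ N := by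
        refine Finset.insert_subset (by simpa [N] using hI') fun σ hσ => ?_
        simpa [N] using Finset.prod_ne_zero_iff.1 hsT σ hσ
      have hNcard : r < N.card := by
        have := Finset.card_le_card hTN
        rw [Finset.card_insert_of_notMem h1T, hT.2] at this
        omega
      have h0 := hq' N.card _ (hZm s hs)
      rw [hr3 _ hNcard (hcard ▸ Finset.card_le_univ N), eval_zero,
        Finset.sum_eq_single_of_mem N (by simp [Finset.mem_powersetCard])] at h0
      · refine Finset.prod_ne_zero_iff.2 (fun σ hσ => ?_) h0.symm
        exact (Finset.mem_filter.1 hσ).2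
      · intro T' hT' hne'
        obtain ⟨σ, hσ, hσN⟩ : ∃ σ ∈ T', σ ∉ N := by
          by_contra! hcon
          exact hne' (Finset.eq_of_subset_of_card_le hcon (Finset.mem_powersetCard.1 hT').2.ge)
        exact Finset.prod_eq_zero hσ (by simpa [N] using hσN)
    obtain ⟨s, hs1, hs2⟩ := (hiso.and (nhdsWithin_le_nhds hnear)).exists
    exact hs1 hs2
  refine (Set.encard_le_encard hsub).trans ?_
  rw [Set.encard_coe_eq_coe_finsetCard]
  exact_mod_cast (Multiset.toFinset_card_le _).trans ((card_roots' _).trans hdeg)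

end Finiteness

/-! ### Comparing the maxima -/

section Maxima

/-- Finiteness matters for the ratios too, since `ENat.toNat` sends `⊤` to 0. -/
theorem maxZeros_ne_top (m n : ℕ) : maxZeros m n ≠ ⊤ := by
  refine ne_top_of_le_ne_top (ENat.natCast_ne_top (n * m.factorial)) (sSup_le ?_)
  rintro _ ⟨f, g, C, hf, hfm, hg, rfl⟩
  refine (C.numZeros_le hf hg).trans ?_
  exact_mod_cast Nat.mul_le_mul_left n (Nat.factorial_le hfm)

theorem maxDim_le (m n : ℕ) : maxDim m n ≤ ((n + 1 : ℕ) : ℕ∞) := by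
  refine sSup_le ?_
  rintro _ ⟨f, C, -, -, rfl⟩
  exact_mod_cast C.dimIntegrals_le n

theorem maxZerosSimple_le_maxZeros {m : ℕ} (hm : 0 < m) (n : ℕ) :
    maxZerosSimple m n ≤ maxZeros m n := by
  refine sSup_le_sSup ?_
  rintro _ ⟨f, g, C, hf, hg, -, rfl⟩
  exact ⟨f, g, C, hf ▸ hm, hf.le, hg.le, rfl⟩

theorem maxDimSimple_le_maxDim {m : ℕ} (hm : 0 < m) (n : ℕ) :
    maxDimSimple m n ≤ maxDim m n := by
  refine sSup_le_sSup ?_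
  rintro _ ⟨f, C, hf, -, rfl⟩
  exact ⟨f, C, hf ▸ hm, hf.le, rfl⟩

theorem maxDimSimple_ne_zero {m : ℕ} (hm : 2 ≤ m) : maxDimSimple m (m - 1) ≠ 0 := by
  obtain ⟨f, C, hf, hC, h⟩ := exists_simple_cycle_dimIntegrals_pos hm
  intro h0
  have : (C.dimIntegrals (m - 1) : ℕ∞) ≤ maxDimSimple m (m - 1) :=
    le_sSup ⟨f, C, hf, hC, rfl⟩
  rw [h0, nonpos_iff_eq_zero] at this
  exact h (by exact_mod_cast this)

theorem le_two_mul_maxZerosSimple {n : ℕ} (hn : 2 ≤ n) :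
    ((n ^ 2 - n : ℕ) : ℕ∞) ≤ 2 * maxZerosSimple (n + 1) n := by
  obtain ⟨f, g, C, hf, hg, hC, h⟩ := exists_simple_cycle_many_zeros hn
  refine h.trans ?_
  gcongr
  exact le_sSup ⟨f, g, C, hf, hg, hC, rfl⟩

/-- Quadratically many zeros against linearly many dimensions. -/
theorem le_toNat_div_toNat {n : ℕ} (hn : 2 ≤ n) {Z D : ℕ∞} (hZ : Z ≠ ⊤)
    (hZn : ((n ^ 2 - n : ℕ) : ℕ∞) ≤ 2 * Z) (hD0 : D ≠ 0) (hD : D ≤ ((n + 1 : ℕ) : ℕ∞)) :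
    ((n : ℝ) - 2) / 2 ≤ (Z.toNat : ℝ) / (D.toNat : ℝ) := by
  lift Z to ℕ using hZ
  lift D to ℕ using ne_top_of_le_ne_top (ENat.natCast_ne_top _) hD
  simp only [ENat.toNat_natCast]
  have h1 : n ^ 2 - n ≤ 2 * Z := by exact_mod_cast hZn
  have h2 : D ≤ n + 1 := by exact_mod_cast hD
  have h3 : 0 < D := Nat.pos_of_ne_zero (by exact_mod_cast hD0)
  have h1' : (n : ℝ) ^ 2 ≤ 2 * Z + n := by exact_mod_cast (by omega : n ^ 2 ≤ 2 * Z + n)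
  have h2' : (D : ℝ) ≤ n + 1 := by exact_mod_cast h2
  have h3' : (0 : ℝ) < D := by exact_mod_cast h3
  have h4 : (2 : ℝ) ≤ n := by exact_mod_cast hn
  -- What remains is (n - 2) D ≤ (n - 2)(n + 1) ≤ n^2 - n ≤ 2 Z.
  rw [div_le_div_iff₀ two_pos h3']
  nlinarith

theorem le_of_sq_sub_le_two_mul {n : ℕ} (hn : 5 ≤ n) {Z D : ℕ∞}
    (hZn : ((n ^ 2 - n : ℕ) : ℕ∞) ≤ 2 * Z) (hD : D ≤ ((n + 1 : ℕ) : ℕ∞)) : D ≤ Z := by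
  refine hD.trans ?_
  induction Z using ENat.recTopCoe with
  | top => exact le_top
  | coe Z =>
    have h1 : n ^ 2 - n ≤ 2 * Z := by exact_mod_cast hZn
    have h2 : n + 1 ≤ Z := by
      have : 5 * n ≤ n ^ 2 := by rw [pow_two]; exact Nat.mul_le_mul_right n hn
      omega
    exact_mod_cast h2

end Maxima

theorem theoremD :
    -- for `m ≥ 2` the maxima are finite and the dimensions are positive
    (∀ m : ℕ, 2 ≤ m →
      maxZeros m (m - 1) ≠ ⊤ ∧ maxDim m (m - 1) ≠ ⊤ ∧ maxDim m (m - 1) ≠ 0 ∧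
      maxZerosSimple m (m - 1) ≠ ⊤ ∧ maxDimSimple m (m - 1) ≠ ⊤ ∧
      maxDimSimple m (m - 1) ≠ 0) ∧
    -- (i) any cycles, (ii) simple cycles
    Tendsto (fun m : ℕ => ratio m (m - 1)) atTop atTop ∧
    Tendsto (fun m : ℕ => ratioSimple m (m - 1)) atTop atTop ∧
    -- the Chebyshev property fails for all large `m`
    (∀ᶠ m : ℕ in atTop, maxDim m (m - 1) ≤ maxZeros m (m - 1) ∧
      maxDimSimple m (m - 1) ≤ maxZerosSimple m (m - 1)) ∧
    -- and so does the asymptotic Chebyshev property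
    ¬ Tendsto (fun m : ℕ => ratio m (m - 1)) atTop (𝓝 1) ∧
    ¬ Tendsto (fun m : ℕ => ratioSimple m (m - 1)) atTop (𝓝 1) := by
  have hfin : ∀ m : ℕ, 2 ≤ m →
      maxZeros m (m - 1) ≠ ⊤ ∧ maxDim m (m - 1) ≠ ⊤ ∧ maxDim m (m - 1) ≠ 0 ∧
      maxZerosSimple m (m - 1) ≠ ⊤ ∧ maxDimSimple m (m - 1) ≠ ⊤ ∧
      maxDimSimple m (m - 1) ≠ 0 := by
    intro m hm
    have hm0 : 0 < m := by omega
    have hZ := maxZeros_ne_top m (m - 1)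
    have hD := ne_top_of_le_ne_top (ENat.natCast_ne_top _) (maxDim_le m (m - 1))
    have hD0 := maxDimSimple_ne_zero hm
    have hDle := maxDimSimple_le_maxDim hm0 (m - 1)
    exact ⟨hZ, hD, fun h => hD0 (nonpos_iff_eq_zero.1 (h ▸ hDle)),
      ne_top_of_le_ne_top hZ (maxZerosSimple_le_maxZeros hm0 _), ne_top_of_le_ne_top hD hDle, hD0⟩
  have hZS : ∀ n : ℕ, 2 ≤ n → ((n ^ 2 - n : ℕ) : ℕ∞) ≤ 2 * maxZerosSimple (n + 1) n :=
    fun n hn => le_two_mul_maxZerosSimple hn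
  have hZ : ∀ n : ℕ, 2 ≤ n → ((n ^ 2 - n : ℕ) : ℕ∞) ≤ 2 * maxZeros (n + 1) n := fun n hn =>
    (hZS n hn).trans (by gcongr; exact maxZerosSimple_le_maxZeros n.succ_pos n)
  have hlim : Tendsto (fun n : ℕ => ((n : ℝ) - 2) / 2) atTop atTop :=
    (tendsto_atTop_add_const_right _ (-2) tendsto_natCast_atTop_atTop).atTop_div_const two_pos
  have h1 : Tendsto (fun m : ℕ => ratio m (m - 1)) atTop atTop := by
    rw [← tendsto_add_atTop_iff_nat 1]
    refine tendsto_atTop_mono' _ ?_ hlim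
    filter_upwards [eventually_ge_atTop 2] with n hn
    obtain ⟨a, -, b, -⟩ := hfin (n + 1) (by omega)
    exact le_toNat_div_toNat hn a (hZ n hn) b (maxDim_le _ _)
  have h2 : Tendsto (fun m : ℕ => ratioSimple m (m - 1)) atTop atTop := by
    rw [← tendsto_add_atTop_iff_nat 1]
    refine tendsto_atTop_mono' _ ?_ hlim
    filter_upwards [eventually_ge_atTop 2] with n hn
    obtain ⟨-, -, -, a, -, b⟩ := hfin (n + 1) (by omega)
    exact le_toNat_div_toNat hn a (hZS n hn) b
      ((maxDimSimple_le_maxDim n.succ_pos _).trans (maxDim_le _ _))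
  refine ⟨hfin, h1, h2, ?_, not_tendsto_nhds_of_tendsto_atTop h1 1,
    not_tendsto_nhds_of_tendsto_atTop h2 1⟩
  filter_upwards [eventually_ge_atTop 6] with m hm
  obtain ⟨n, rfl⟩ : ∃ n, m = n + 1 := ⟨m - 1, by omega⟩
  rw [Nat.add_sub_cancel]
  exact ⟨le_of_sq_sub_le_two_mul (by omega) (hZ n (by omega)) (maxDim_le _ _),
    le_of_sq_sub_le_two_mul (by omega) (hZS n (by omega))
      ((maxDimSimple_le_maxDim n.succ_pos _).trans (maxDim_le _ _))⟩
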